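/- Let $S\subset\mathbb R^2$ be compact, let $|\alpha|<1$, $|\beta|<1$, $\delta t>0$, and for $s\in S$ put $M_s=\exp\big(\max\{\|s^2-u^2\|^2:u\in S\}\big)$, where $v^2=(v_1^2,v_2^2)$ for $v\in\mathbb R^2$. On a common probability space let $\{X(s,0)\}_{s\in S}$, $\{Y(s,0)\}_{s\in S}$ and $\{V(u)\}_{u\in\mathbb R}$ be real-valued random functions such that: (A1) $X(\cdot,0)$ is a centered Gaussian process whose covariance function has bounded first-order partial derivatives, i.e. it is the restriction to $S\times S$ of a function that has all first-order partial derivatives, with a common bound, on an open set containing $S\times S$; (A2) the same holds for $Y(\cdot,0)$; (A3) $V$ is a centered Gaussian process on $\mathbb R$ with almost surely differentiable sample paths, whose covariance function $c_v$ on $\mathbb R^2$ is twice continuously differentiable with (globally) Lipschitz continuous mixed partial derivative $\partial_1\partial_2 c_v$ (for instance $c_v(x_1,x_2)=\sigma^2e^{-\eta_3|x_1-x_2|^2}$). For $h\ge 1$ define recursively $$Y(s,h\delta t)=\beta\,Y(s,(h-1)\delta t)+\frac{\delta t}{M_s}\Big\{\alpha X(s,(h-1)\delta t)-\frac{\delta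 t}{2}V'\big(Y(s,(h-1)\delta t)\big)\Big\},$$ $$X(s,h\delta t)=\alpha^2X(s,(h-1)\delta t)-\frac{\delta t}{2}\Big\{\alpha V'\big(Y(s,(h-1)\delta t)\big)+V'\big(Y(s,h\delta t)\big)\Big\}.$$ Then for every $h\ge1$ the processes $s\mapsto Y(s,h\delta t)$ and $s\mapsto X(s,h\delta t)$ are mean-square continuous on $S$: all their second moments are finite, and for every $s_0\in S$, $E|Y(s,h\delta t)-Y(s_0,h\delta t)|^2\to0$ and $E|X(s,h\delta t)-X(s_0,h\delta t)|^2\to0$ as $s\to s_0$ in $S$. -/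

import Mathlib

open MeasureTheory ProbabilityTheory Filter Topology
open scoped NNReal ENNReal

/-- The Euclidean plane, in which the spatial domain lies. -/
abbrev Plane : Type := EuclideanSpace ℝ (Fin 2)

/-- The coordinatewise square `v² = (v₁², v₂²)`. -/
noncomputable def coordSq (v : Plane) : Plane := WithLp.toLp 2 (fun i => v i ^ 2)

/-- The mass `M_s = exp (max {‖s² - u²‖² : u ∈ S})`. For compact nonempty `S` the supremum is
attained, so it is the maximum. -/
noncomputable def mass (S : Set Plane) (s : Plane) : ℝ :=
  Real.exp (⨆ u : S, ‖coordSq s - coordSq u‖ ^ 2)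

/-- A function `c` on `S × S` has bounded partial derivatives: it is the restriction of a function
which, on some open set containing `S × S`, has all four first-order partial derivatives, bounded
by a common constant. -/
def HasBoundedPartials (S : Set Plane) (c : S → S → ℝ) : Prop :=
  ∃ (U : Set (Plane × Plane)) (k : Plane × Plane → ℝ) (C : ℝ),
    IsOpen U ∧ S ×ˢ S ⊆ U ∧ (∀ s s' : S, k ((s : Plane), (s' : Plane)) = c s s') ∧
    ∀ p ∈ U, ∀ i : Fin 2,
      (LineDifferentiableAt ℝ k p (EuclideanSpace.single i 1, 0) ∧
        |lineDeriv ℝ k p (EuclideanSpace.single i 1, 0)| ≤ C) ∧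
      (LineDifferentiableAt ℝ k p (0, EuclideanSpace.single i 1) ∧
        |lineDeriv ℝ k p (0, EuclideanSpace.single i 1)| ≤ C)

/-- A centered Gaussian process on `S` whose covariance function has bounded partial derivatives.
(Symmetry and nonnegative definiteness hold for every covariance function.) -/
structure IsInitialField {Ω : Type*} [MeasurableSpace Ω] (S : Set Plane) (Z : S → Ω → ℝ)
    (P : Measure Ω) : Prop where
  isGaussianProcess : IsGaussianProcess Z P
  centered : ∀ s, ∫ ω, Z s ω ∂P = 0
  boundedPartials : HasBoundedPartials S (fun s s' => cov[Z s, Z s'; P])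

/-- A centered Gaussian random function on the real line with differentiable sample paths, whose
covariance function is twice continuously differentiable with Lipschitz continuous mixed second
partial derivative. -/
structure IsGaussianPotential {Ω : Type*} [MeasurableSpace Ω] (V : ℝ → Ω → ℝ)
    (P : Measure Ω) : Prop where
  isGaussianProcess : IsGaussianProcess V P
  centered : ∀ u, ∫ ω, V u ω ∂P = 0
  contDiff_cov : ContDiff ℝ 2 (fun p : ℝ × ℝ => cov[V p.1, V p.2; P])
  lipschitz_mixed : ∃ K : ℝ≥0, LipschitzWith K
    (fun p : ℝ × ℝ => deriv (fun u => deriv (fun v => cov[V u, V v; P]) p.2) p.1)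
  differentiable_paths : ∀ᵐ ω ∂P, Differentiable ℝ (fun u => V u ω)

/-- One step `(y, x) ↦ (y', x')` of the modified leap-frog scheme with mass `m` and force `g`
(the derivative of the potential):
`y' = β y + δt m⁻¹ (α x - (δt / 2) g(y))` and `x' = α² x - (δt / 2) (α g(y) + g(y'))`. -/
noncomputable def leapfrogStep (α β δt m : ℝ) (g : ℝ → ℝ) (q : ℝ × ℝ) : ℝ × ℝ :=
  let y := q.1
  let x := q.2
  let y' := β * y + δt * m⁻¹ * (α * x - δt / 2 * g y)
  (y', α ^ 2 * x - δt / 2 * (α * g y + g y'))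

/-- The pair `(Y(s, h δt), X(s, h δt))`, started from `(Y(s, 0), X(s, 0)) = (Y₀ s, X₀ s)`. -/
noncomputable def leapfrogState {Ω : Type*} {S : Set Plane} (α β δt : ℝ) (V : ℝ → Ω → ℝ)
    (Y₀ X₀ : S → Ω → ℝ) (h : ℕ) (s : S) (ω : Ω) : ℝ × ℝ :=
  match h with
  | 0 => (Y₀ s ω, X₀ s ω)
  | h + 1 => leapfrogStep α β δt (mass S s) (deriv (fun u => V u ω))
      (leapfrogState α β δt V Y₀ X₀ h s ω)

/-- The observed process at time `h δt`, that is, `(s, ω) ↦ Y(s, h δt)(ω)`. -/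
noncomputable def observedProcess {Ω : Type*} {S : Set Plane} (α β δt : ℝ) (V : ℝ → Ω → ℝ)
    (Y₀ X₀ : S → Ω → ℝ) (h : ℕ) (s : S) (ω : Ω) : ℝ :=
  (leapfrogState α β δt V Y₀ X₀ h s ω).1

/-- The latent process at time `h δt`, that is, `(s, ω) ↦ X(s, h δt)(ω)`. -/
noncomputable def latentProcess {Ω : Type*} {S : Set Plane} (α β δt : ℝ) (V : ℝ → Ω → ℝ)
    (Y₀ X₀ : S → Ω → ℝ) (h : ℕ) (s : S) (ω : Ω) : ℝ :=
  (leapfrogState α β δt V Y₀ X₀ h s ω).2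

/-- Mean-square continuity of a real process: all second moments are finite and
`E |Z(s) - Z(s₀)|² → 0` as `s → s₀`, for every `s₀`. -/
def MeanSquareContinuous {Ω T : Type*} [MeasurableSpace Ω] [TopologicalSpace T]
    (Z : T → Ω → ℝ) (P : Measure Ω) : Prop :=
  (∀ s, MemLp (Z s) 2 P) ∧
    ∀ s₀, Tendsto (fun s => ∫ ω, (Z s ω - Z s₀ ω) ^ 2 ∂P) (𝓝 s₀) (𝓝 0)

/-! After one step `Y` depends on `V`, so `V'(Y)` is not Gaussian and its moments cannot be read off
from the law of `V'(u)` at fixed `u`. What is needed is a pathwise bound holding for all `u` at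
once: almost surely `V'` is continuous and `|V'(u)| ≤ G (1 + u²)`, where `G` can be taken in any
prescribed `L^p`, `p < ∞`.

Given this, continuity in `L^p` for all finite `p` propagates through the scheme. The class is
closed under sums, products and continuous deterministic factors (such as `1 / M_s`), and, by
Vitali's theorem, under composition with `V'` (`comp_hasQuadraticGrowth`). A single exponent would
not do, since Hölder's inequality for products doubles it.

The bound on `V'` is a Kolmogorov chaining argument on the slopes of `V` over dyadic intervals.
Covariances of slopes are values of the mixed derivative of the covariance, so its Lipschitz
continuity bounds the variance of the jump between neighbouring slopes by `C 2⁻ⁿ`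
(`exists_variance_jump_le`). For Gaussian variables the moments of order `2m` are then of order
`2⁻ᵐⁿ`, and a weighted sum over all dyadic intervals produces one random constant controlling every
jump (`exists_jumpBound`). As paths are differentiable, the slopes converge to `V'`, which inherits
continuity and growth.

The initial fields are Gaussian, so all their `L^p` increments are governed by variances, which tend
to zero because the covariance has bounded partials. -/

/-! ### Processes continuous in every `L^p`. -/

/-- A real process is continuous in every `L^p`, `1 ≤ p < ∞`. -/
def ContinuousInLp {Ω T : Type*} [MeasurableSpace Ω] [TopologicalSpace T]
    (Z : T → Ω → ℝ) (P : Measure Ω) : Prop :=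
  ∀ p : ℝ≥0∞, 1 ≤ p → p ≠ ∞ → (∀ s, MemLp (Z s) p P) ∧
    ∀ s₀, Tendsto (fun s => eLpNorm (Z s - Z s₀) p P) (𝓝 s₀) (𝓝 0)

theorem holderTriple_two_mul (p : ℝ≥0∞) : ENNReal.HolderTriple (2 * p) (2 * p) p := by
  constructor
  rw [ENNReal.mul_inv (by simp) (by simp), ← add_mul, ENNReal.inv_two_add_inv_two, one_mul]

theorem one_le_two_mul_ennreal {p : ℝ≥0∞} (hp : 1 ≤ p) : 1 ≤ 2 * p :=
  hp.trans (by rw [two_mul]; exact le_self_add)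

theorem eLpNorm_mul_le_two_mul {Ω : Type*} [MeasurableSpace Ω] {P : Measure Ω} {p : ℝ≥0∞}
    {f g : Ω → ℝ} (hf : AEStronglyMeasurable f P) (hg : AEStronglyMeasurable g P) :
    eLpNorm (f * g) p P ≤ eLpNorm f (2 * p) P * eLpNorm g (2 * p) P := by
  have := holderTriple_two_mul p
  have h := eLpNorm_le_eLpNorm_mul_eLpNorm'_of_norm (p := 2 * p) (q := 2 * p) (r := p) hf hg
    (fun a b : ℝ => a * b) 1 (ae_of_all _ fun ω => by simp)
  simpa using! h

/-- A random function of at most quadratic growth with continuous paths, whose growth constant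
has moments of all orders. -/
structure HasQuadraticGrowth {Ω : Type*} [MeasurableSpace Ω] (g : Ω → ℝ → ℝ)
    (P : Measure Ω) : Prop where
  continuous_paths : ∀ᵐ ω ∂P, Continuous (g ω)
  growth : ∀ p : ℝ≥0∞, 1 ≤ p → p ≠ ∞ → ∃ G : Ω → ℝ, MemLp G p P ∧
    ∀ᵐ ω ∂P, ∀ u, |g ω u| ≤ G ω * (1 + u ^ 2)
  aemeasurable_comp : ∀ Y : Ω → ℝ, AEMeasurable Y P → AEMeasurable (fun ω => g ω (Y ω)) P

namespace ContinuousInLp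

variable {Ω T : Type*} [MeasurableSpace Ω] [TopologicalSpace T] {P : Measure Ω}
  {Z W : T → Ω → ℝ}

theorem congr (hZ : ContinuousInLp Z P) (h : ∀ s, W s = Z s) : ContinuousInLp W P := by
  rwa [show W = Z from funext h]

theorem add (hZ : ContinuousInLp Z P) (hW : ContinuousInLp W P) :
    ContinuousInLp (fun s ω => Z s ω + W s ω) P := by
  intro p hp hp'
  obtain ⟨hZ1, hZ2⟩ := hZ p hp hp'
  obtain ⟨hW1, hW2⟩ := hW p hp hp'
  refine ⟨fun s => (hZ1 s).add (hW1 s), fun s₀ => ?_⟩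
  have h := (hZ2 s₀).add (hW2 s₀)
  rw [add_zero] at h
  refine tendsto_of_tendsto_of_tendsto_of_le_of_le tendsto_const_nhds h (fun _ => zero_le)
    fun s => ?_
  refine le_trans (le_of_eq ?_) (eLpNorm_add_le ((hZ1 s).sub (hZ1 s₀)).1
    ((hW1 s).sub (hW1 s₀)).1 hp)
  congr 1
  ext ω
  simp only [Pi.sub_apply, Pi.add_apply]
  ring

theorem mul (hZ : ContinuousInLp Z P) (hW : ContinuousInLp W P) :
    ContinuousInLp (fun s ω => Z s ω * W s ω) P := by
  intro p hp hp'
  have := holderTriple_two_mul p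
  have h2 := one_le_two_mul_ennreal hp
  have h2' : 2 * p ≠ ∞ := ENNReal.mul_ne_top (by simp) hp'
  obtain ⟨hZ1, hZ2⟩ := hZ _ h2 h2'
  obtain ⟨hW1, hW2⟩ := hW _ h2 h2'
  refine ⟨fun s => (hW1 s).mul (hZ1 s), fun s₀ => ?_⟩
  have h := (((ENNReal.Tendsto.mul (hZ2 s₀) (.inr ENNReal.zero_ne_top) (hW2 s₀)
    (.inr ENNReal.zero_ne_top)).add
    (ENNReal.Tendsto.mul_const (hZ2 s₀) (.inr (hW1 s₀).2.ne))).add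
    (ENNReal.Tendsto.const_mul (hW2 s₀) (.inr (hZ1 s₀).2.ne)))
  simp only [mul_zero, zero_mul, add_zero] at h
  refine tendsto_of_tendsto_of_tendsto_of_le_of_le tendsto_const_nhds h (fun _ => zero_le)
    fun s => ?_
  have a := (hZ1 s).sub (hZ1 s₀)
  have b := (hW1 s).sub (hW1 s₀)
  have e : (fun ω => Z s ω * W s ω) - (fun ω => Z s₀ ω * W s₀ ω) =
      ((Z s - Z s₀) * (W s - W s₀) + (Z s - Z s₀) * W s₀) + Z s₀ * (W s - W s₀) := by
    ext ω
    simp only [Pi.sub_apply, Pi.add_apply, Pi.mul_apply]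
    ring
  rw [e]
  have h1 : MemLp ((Z s - Z s₀) * (W s - W s₀)) p P := b.mul a
  have h2 : MemLp ((Z s - Z s₀) * W s₀) p P := (hW1 s₀).mul a
  have h3 : MemLp (Z s₀ * (W s - W s₀)) p P := b.mul (hZ1 s₀)
  refine (eLpNorm_add_le (h1.add h2).1 h3.1 hp).trans ?_
  exact add_le_add ((eLpNorm_add_le h1.1 h2.1 hp).trans
    (add_le_add (eLpNorm_mul_le_two_mul a.1 b.1) (eLpNorm_mul_le_two_mul a.1 (hW1 s₀).1)))
    (eLpNorm_mul_le_two_mul (hZ1 s₀).1 b.1)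

theorem of_continuous [IsProbabilityMeasure P] {c : T → ℝ} (hc : Continuous c) :
    ContinuousInLp (fun s (_ : Ω) => c s) P := by
  intro p hp hp'
  refine ⟨fun s => memLp_const _, fun s₀ => ?_⟩
  have e : ∀ s, eLpNorm ((fun _ : Ω => c s) - fun _ => c s₀) p P = ‖c s - c s₀‖ₑ := by
    intro s
    have : ((fun _ : Ω => c s) - fun _ => c s₀) = fun _ => c s - c s₀ := rfl
    rw [this, eLpNorm_const _ (by positivity) (NeZero.ne P)]
    simp
  simp_rw [e]
  have h : Tendsto (fun s => ‖c s - c s₀‖ₑ) (𝓝 s₀) (𝓝 ‖c s₀ - c s₀‖ₑ) :=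
    (((hc.sub continuous_const).enorm).tendsto s₀)
  simpa using h

theorem continuous_mul [IsProbabilityMeasure P] {c : T → ℝ} (hc : Continuous c)
    (hZ : ContinuousInLp Z P) : ContinuousInLp (fun s ω => c s * Z s ω) P :=
  (of_continuous hc).mul hZ

theorem const_mul [IsProbabilityMeasure P] (c : ℝ) (hZ : ContinuousInLp Z P) :
    ContinuousInLp (fun s ω => c * Z s ω) P :=
  hZ.continuous_mul continuous_const

theorem tendstoInMeasure (hZ : ContinuousInLp Z P) (s₀ : T) :
    TendstoInMeasure P Z (𝓝 s₀) (Z s₀) :=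
  tendstoInMeasure_of_tendsto_eLpNorm (p := 1) one_ne_zero
    (fun s => ((hZ 1 le_rfl ENNReal.one_ne_top).1 s).1)
    ((hZ 1 le_rfl ENNReal.one_ne_top).1 s₀).1 ((hZ 1 le_rfl ENNReal.one_ne_top).2 s₀)

/-- Vitali's theorem along sequences: path continuity gives convergence in measure, and the
dominating variables `G (1 + Z²)`, which converge in `L^p`, give uniform integrability. -/
theorem comp_hasQuadraticGrowth [FirstCountableTopology T] [IsProbabilityMeasure P]
    {g : Ω → ℝ → ℝ} (hg : HasQuadraticGrowth g P) (hZ : ContinuousInLp Z P) :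
    ContinuousInLp (fun s ω => g ω (Z s ω)) P := by
  intro p hp hp'
  have := holderTriple_two_mul p
  have h2 := one_le_two_mul_ennreal hp
  have h2' : 2 * p ≠ ∞ := ENNReal.mul_ne_top (by simp) hp'
  obtain ⟨G, hG, hgG⟩ := hg.growth _ h2 h2'
  have hQ : ContinuousInLp (fun s ω => 1 + Z s ω * Z s ω) P :=
    (of_continuous continuous_const).add (hZ.mul hZ)
  obtain ⟨hQ1, hQ2⟩ := hQ _ h2 h2'
  set Q : T → Ω → ℝ := fun s ω => 1 + Z s ω * Z s ω with hQdef
  have hm : ∀ s, AEStronglyMeasurable (fun ω => g ω (Z s ω)) P := fun s =>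
    (hg.aemeasurable_comp _ ((hZ 1 le_rfl ENNReal.one_ne_top).1 s).1.aemeasurable).aestronglyMeasurable
  have hGQ : ∀ s, MemLp (G * Q s) p P := fun s => (hQ1 s).mul hG
  have hle : ∀ s, ∀ᵐ ω ∂P, ‖g ω (Z s ω)‖ ≤ ‖(G * Q s) ω‖ := by
    intro s
    filter_upwards [hgG] with ω hω
    refine (hω (Z s ω)).trans (le_trans (le_of_eq ?_) (le_abs_self _))
    simp only [Pi.mul_apply, hQdef]
    ring
  have hmem : ∀ s, MemLp (fun ω => g ω (Z s ω)) p P := fun s => (hGQ s).mono (hm s) (hle s)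
  refine ⟨hmem, fun s₀ => ?_⟩
  refine tendsto_of_seq_tendsto fun x hx => ?_
  have hGQt : Tendsto (fun n => eLpNorm (G * Q (x n) - G * Q s₀) p P) atTop (𝓝 0) := by
    have h := ENNReal.Tendsto.const_mul (a := eLpNorm G (2 * p) P) ((hQ2 s₀).comp hx)
      (.inr hG.2.ne)
    rw [mul_zero] at h
    refine tendsto_of_tendsto_of_tendsto_of_le_of_le tendsto_const_nhds h (fun _ => zero_le)
      fun n => ?_
    rw [← mul_sub]
    exact eLpNorm_mul_le_two_mul hG.1 ((hQ1 _).sub (hQ1 _)).1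
  have hui := unifIntegrable_of_tendsto_Lp hp hp' (fun n => hGQ (x n)) (hGQ s₀) hGQt
  refine tendsto_Lp_finite_of_tendstoInMeasure (f := fun n ω => g ω (Z (x n) ω)) hp hp'
    (fun n => hm _) (hmem s₀) ?_ ?_
  · intro ε hε
    obtain ⟨δ, hδ, h⟩ := hui hε
    refine ⟨δ, hδ, fun i s hs hμ => (eLpNorm_mono_ae ?_).trans (h i s hs hμ)⟩
    filter_upwards [hle (x i)] with ω hω
    by_cases hωs : ω ∈ s
    · simpa only [Set.indicator_of_mem hωs] using hω
    · simp only [Set.indicator_of_notMem hωs, le_refl]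
  -- A random function need not preserve convergence in measure uniformly, so one passes to almost
  -- surely convergent subsequences, where continuity of each path suffices.
  · rw [exists_seq_tendstoInMeasure_atTop_iff fun n => hm _]
    intro ns hns
    obtain ⟨ns', h1, h2⟩ :=
      ((hZ.tendstoInMeasure s₀).comp (hx.comp hns.tendsto_atTop)).exists_seq_tendsto_ae
    refine ⟨ns', h1, ?_⟩
    filter_upwards [h2, hg.continuous_paths] with ω hω hc
    exact (hc.tendsto _).comp hω

theorem meanSquareContinuous (hZ : ContinuousInLp Z P) : MeanSquareContinuous Z P := by
  obtain ⟨h1, h2⟩ := hZ 2 (by norm_num) (by norm_num)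
  refine ⟨h1, fun s₀ => ?_⟩
  have h := (ENNReal.tendsto_toReal ENNReal.zero_ne_top).comp (h2 s₀)
  have h' := h.pow 2
  simp only [ENNReal.toReal_zero, ne_eq, OfNat.ofNat_ne_zero, not_false_eq_true, zero_pow] at h'
  refine h'.congr fun s => ?_
  have hs := (h1 s).sub (h1 s₀)
  have hI : 0 ≤ ∫ ω, ‖(Z s - Z s₀) ω‖ ^ (2 : ℝ) ∂P :=
    integral_nonneg fun ω => by positivity
  simp only [Function.comp_apply]
  rw [hs.eLpNorm_eq_integral_rpow_norm (by norm_num) (by norm_num)]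
  simp only [ENNReal.toReal_ofNat]
  rw [ENNReal.toReal_ofReal (by positivity), ← Real.rpow_natCast, ← Real.rpow_mul hI]
  norm_num

end ContinuousInLp

/-! ### Dyadic slopes of a function on the line. -/

/-- The slope of `f` over the dyadic interval `[k / 2 ^ n, (k + 1) / 2 ^ n]`. -/
noncomputable def dyadicSlope (f : ℝ → ℝ) (n : ℕ) (k : ℤ) : ℝ :=
  2 ^ n * (f ((k + 1) / 2 ^ n) - f (k / 2 ^ n))

theorem floor_div_two_pow_mem (n : ℕ) (u : ℝ) :
    (⌊2 ^ n * u⌋ : ℝ) / 2 ^ n ≤ u ∧ u < ((⌊2 ^ n * u⌋ : ℝ) + 1) / 2 ^ n := by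
  have h : (0 : ℝ) < 2 ^ n := by positivity
  rw [div_le_iff₀ h, lt_div_iff₀ h, mul_comm u]
  exact ⟨Int.floor_le _, Int.lt_floor_add_one _⟩

theorem abs_floor_div_two_pow_le (n : ℕ) (u : ℝ) :
    |(⌊2 ^ n * u⌋ : ℝ)| / 2 ^ n ≤ 1 + |u| := by
  have h : (1 : ℝ) ≤ 2 ^ n := one_le_pow₀ (by norm_num)
  have h0 : (0 : ℝ) < 2 ^ n := by positivity
  rw [div_le_iff₀ h0, abs_le]
  have h1 := Int.floor_le (2 ^ n * u)
  have h2 := Int.lt_floor_add_one (2 ^ n * u)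
  have h3 := mul_le_mul_of_nonneg_left (neg_abs_le u) h0.le
  have h4 := mul_le_mul_of_nonneg_left (le_abs_self u) h0.le
  constructor <;> nlinarith

theorem tendsto_dyadicSlope {f : ℝ → ℝ} {f' u : ℝ} (hf : HasDerivAt f f' u) :
    Tendsto (fun n : ℕ => dyadicSlope f n ⌊2 ^ n * u⌋) atTop (𝓝 f') := by
  rw [Metric.tendsto_atTop]
  intro ε hε
  have h := (hasDerivAt_iff_isLittleO.1 hf).def (half_pos hε)
  obtain ⟨δ, hδ, hb⟩ := Metric.eventually_nhds_iff.1 h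
  obtain ⟨N, hN⟩ := exists_pow_lt_of_lt_one hδ (show (1 / 2 : ℝ) < 1 by norm_num)
  refine ⟨N, fun n hn => ?_⟩
  have hp : (0 : ℝ) < 2 ^ n := by positivity
  obtain ⟨h1, h2⟩ := floor_div_two_pow_mem n u
  set a : ℝ := (⌊2 ^ n * u⌋ : ℝ) / 2 ^ n with ha
  have hab : ((⌊2 ^ n * u⌋ : ℝ) + 1) / 2 ^ n = a + (1 / 2) ^ n := by
    rw [ha, add_div, one_div_pow]
  have hs : dyadicSlope f n ⌊2 ^ n * u⌋ = 2 ^ n * (f (a + (1 / 2) ^ n) - f a) := by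
    rw [dyadicSlope, hab]
  rw [hab] at h2
  have hq : ((1 / 2 : ℝ)) ^ n < δ := lt_of_le_of_lt
    (pow_le_pow_of_le_one (by norm_num) (by norm_num) hn) hN
  have hpq : (2 : ℝ) ^ n * (1 / 2) ^ n = 1 := by rw [← mul_pow]; norm_num
  set q : ℝ := (1 / 2) ^ n
  have ea := hb (y := a) (by rw [Real.dist_eq, abs_lt]; constructor <;> linarith)
  have eb := hb (y := a + q) (by rw [Real.dist_eq, abs_lt]; constructor <;> linarith)
  simp only [Real.norm_eq_abs, smul_eq_mul] at ea eb
  rw [abs_of_nonpos (show a - u ≤ 0 by linarith)] at ea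
  rw [abs_of_nonneg (show 0 ≤ a + q - u by linarith)] at eb
  -- The point `u` lies between the endpoints, so their distances to `u` add up to `q` and the two
  -- linearization errors add up to at most `ε / 2 * q`.
  have key : |f (a + q) - f a - q * f'| ≤ ε / 2 * q := by
    rw [abs_le] at *
    constructor <;> nlinarith [ea.1, ea.2, eb.1, eb.2]
  rw [hs, Real.dist_eq]
  have e : 2 ^ n * (f (a + q) - f a) - f' = 2 ^ n * (f (a + q) - f a - q * f') := by
    linear_combination f' * hpq
  rw [e, abs_mul, abs_of_pos hp]
  calc 2 ^ n * |f (a + q) - f a - q * f'| ≤ 2 ^ n * (ε / 2 * q) := by gcongr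
    _ = ε / 2 := by linear_combination (ε / 2) * hpq
    _ < ε := by linarith

theorem dyadicSlope_eq_half_add (f : ℝ → ℝ) (n : ℕ) (k : ℤ) :
    dyadicSlope f n k = (dyadicSlope f (n + 1) (2 * k) + dyadicSlope f (n + 1) (2 * k + 1)) / 2 := by
  have hp : (2 : ℝ) ^ n ≠ 0 := by positivity
  have h1 : ((2 * k : ℤ) : ℝ) / 2 ^ (n + 1) = k / 2 ^ n := by
    push_cast; rw [pow_succ]; field_simp
  have h2 : (((2 * k + 1 : ℤ) : ℝ) + 1) / 2 ^ (n + 1) = (k + 1) / 2 ^ n := by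
    push_cast; rw [pow_succ]; field_simp; ring
  have h3 : (((2 * k : ℤ) : ℝ) + 1) / 2 ^ (n + 1) = ((2 * k + 1 : ℤ) : ℝ) / 2 ^ (n + 1) := by
    push_cast; rfl
  simp only [dyadicSlope]
  rw [h1, h2, h3, pow_succ]
  ring

theorem floor_two_pow_succ (n : ℕ) (u : ℝ) :
    ⌊2 ^ (n + 1) * u⌋ = 2 * ⌊2 ^ n * u⌋ ∨ ⌊2 ^ (n + 1) * u⌋ = 2 * ⌊2 ^ n * u⌋ + 1 := by
  have h1 := Int.floor_le (2 ^ n * u)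
  have h2 := Int.lt_floor_add_one (2 ^ n * u)
  have e : (2 : ℝ) ^ (n + 1) * u = 2 * (2 ^ n * u) := by ring
  rw [e]
  have h3 : 2 * ⌊2 ^ n * u⌋ ≤ ⌊2 * (2 ^ n * u)⌋ := Int.le_floor.2 (by push_cast; linarith)
  have h4 : ⌊2 * (2 ^ n * u)⌋ < 2 * ⌊2 ^ n * u⌋ + 2 := Int.floor_lt.2 (by push_cast; linarith)
  omega

/-! ### From jump bounds to continuity and growth of the derivative. -/

/-- Geometric decay of the jumps between neighbouring dyadic slopes, with linear growth in the
position. -/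
def DyadicJumpBound (f : ℝ → ℝ) (R ρ : ℝ) : Prop :=
  ∀ (n : ℕ) (k : ℤ), |dyadicSlope f n (k + 1) - dyadicSlope f n k| ≤ R * ρ ^ n * (1 + |(k : ℝ)| / 2 ^ n)

namespace DyadicJumpBound

variable {f : ℝ → ℝ} {R ρ : ℝ}

/-- A slope is the mean of the slopes over the two halves, so it differs from either by half the
jump between them. -/
theorem abs_sub_succ_le (h : DyadicJumpBound f R ρ) (hR : 0 ≤ R) (h0 : 0 ≤ ρ) (h1 : ρ < 1)
    (n : ℕ) (u : ℝ) :
    |dyadicSlope f n ⌊2 ^ n * u⌋ - dyadicSlope f (n + 1) ⌊2 ^ (n + 1) * u⌋| ≤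
      R * (2 + |u|) * ρ ^ n := by
  have hj := h (n + 1) (2 * ⌊2 ^ n * u⌋)
  have hk := abs_floor_div_two_pow_le n u
  have e : |((2 * ⌊2 ^ n * u⌋ : ℤ) : ℝ)| / 2 ^ (n + 1) = |(⌊2 ^ n * u⌋ : ℝ)| / 2 ^ n := by
    push_cast
    rw [abs_mul, abs_of_pos (two_pos), pow_succ]
    field_simp
  rw [e] at hj
  have hj' : |dyadicSlope f (n + 1) (2 * ⌊2 ^ n * u⌋ + 1) - dyadicSlope f (n + 1) (2 * ⌊2 ^ n * u⌋)|
      ≤ R * (2 + |u|) * ρ ^ n := by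
    refine hj.trans ?_
    have hρ : ρ ^ (n + 1) ≤ ρ ^ n := pow_le_pow_of_le_one h0 h1.le (Nat.le_succ n)
    calc R * ρ ^ (n + 1) * (1 + |(⌊2 ^ n * u⌋ : ℝ)| / 2 ^ n) ≤ R * ρ ^ n * (2 + |u|) := by
          gcongr ?_ * ?_
          · gcongr
          · linarith
      _ = _ := by ring
  have hh := dyadicSlope_eq_half_add f n ⌊2 ^ n * u⌋
  rw [abs_le] at hj' ⊢
  rcases floor_two_pow_succ n u with h' | h' <;> rw [h', hh] <;> constructor <;>
    linarith [hj'.1, hj'.2]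

theorem abs_sub_deriv_le (h : DyadicJumpBound f R ρ) (hR : 0 ≤ R) (h0 : 0 ≤ ρ) (h1 : ρ < 1)
    (hf : Differentiable ℝ f) (n : ℕ) (u : ℝ) :
    |dyadicSlope f n ⌊2 ^ n * u⌋ - deriv f u| ≤ R * (2 + |u|) * ρ ^ n / (1 - ρ) :=
  dist_le_of_le_geometric_of_tendsto ρ (R * (2 + |u|)) h1
    (fun n => h.abs_sub_succ_le hR h0 h1 n u) (tendsto_dyadicSlope (hf u).hasDerivAt) n

theorem abs_sub_of_close (h : DyadicJumpBound f R ρ) (hR : 0 ≤ R) (h0 : 0 ≤ ρ) {n : ℕ} {u v : ℝ}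
    (huv : u ≤ v) (hv : v ≤ u + (1 / 2) ^ n) :
    |dyadicSlope f n ⌊2 ^ n * u⌋ - dyadicSlope f n ⌊2 ^ n * v⌋| ≤ R * (2 + |u|) * ρ ^ n := by
  have hp : (0 : ℝ) < 2 ^ n := by positivity
  have hpq : (2 : ℝ) ^ n * (1 / 2) ^ n = 1 := by rw [← mul_pow]; norm_num
  have a1 : ⌊2 ^ n * u⌋ ≤ ⌊2 ^ n * v⌋ := Int.floor_le_floor (by gcongr)
  have a2 : ⌊2 ^ n * v⌋ ≤ ⌊2 ^ n * u⌋ + 1 := by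
    rw [← Int.floor_add_one]
    refine Int.floor_le_floor ?_
    nlinarith
  have hb : (0 : ℝ) ≤ R * (2 + |u|) * ρ ^ n := by positivity
  rcases (show ⌊2 ^ n * v⌋ = ⌊2 ^ n * u⌋ ∨ ⌊2 ^ n * v⌋ = ⌊2 ^ n * u⌋ + 1 by omega) with e | e
  · rw [e, sub_self, abs_zero]; exact hb
  · rw [e, abs_sub_comm]
    refine (h n _).trans ?_
    have hk := abs_floor_div_two_pow_le n u
    calc R * ρ ^ n * (1 + |(⌊2 ^ n * u⌋ : ℝ)| / 2 ^ n) ≤ R * ρ ^ n * (2 + |u|) := by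
          refine mul_le_mul_of_nonneg_left ?_ (by positivity)
          linarith
      _ = _ := by ring

theorem abs_deriv_sub_deriv_le (h : DyadicJumpBound f R ρ) (hR : 0 ≤ R) (h0 : 0 ≤ ρ) (h1 : ρ < 1)
    (hf : Differentiable ℝ f) {n : ℕ} {u v : ℝ} (huv : u ≤ v) (hv : v ≤ u + (1 / 2) ^ n) :
    |deriv f u - deriv f v| ≤ (R * (2 + |u|) + (R * (2 + |u|) + R * (2 + |v|)) / (1 - ρ)) * ρ ^ n := by
  have a := h.abs_sub_of_close hR h0 huv hv
  have b := h.abs_sub_deriv_le hR h0 h1 hf n u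
  have c := h.abs_sub_deriv_le hR h0 h1 hf n v
  have e : (R * (2 + |u|) + (R * (2 + |u|) + R * (2 + |v|)) / (1 - ρ)) * ρ ^ n =
    R * (2 + |u|) * ρ ^ n + R * (2 + |u|) * ρ ^ n / (1 - ρ) + R * (2 + |v|) * ρ ^ n / (1 - ρ) := by
    ring
  rw [e]
  rw [abs_le] at *
  constructor <;> linarith [a.1, a.2, b.1, b.2, c.1, c.2]

theorem continuous_deriv (h : DyadicJumpBound f R ρ) (hR : 0 ≤ R) (h0 : 0 ≤ ρ) (h1 : ρ < 1)
    (hf : Differentiable ℝ f) : Continuous (deriv f) := by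
  rw [continuous_iff_continuousAt]
  intro u
  rw [ContinuousAt, Metric.tendsto_nhds]
  intro ε hε
  -- Only `v` with `|v| ≤ |u| + 1` matter, so `3 + |u|` dominates both `2 + |u|` and `2 + |v|`.
  set K := R * (3 + |u|) + (R * (3 + |u|) + R * (3 + |u|)) / (1 - ρ)
  have hlim : Tendsto (fun n : ℕ => K * ρ ^ n) atTop (𝓝 0) := by
    simpa using (tendsto_pow_atTop_nhds_zero_of_lt_one h0 h1).const_mul K
  obtain ⟨n, hn⟩ := ((tendsto_order.1 hlim).2 ε hε).exists
  have hq : (0 : ℝ) < (1 / 2) ^ n := by positivity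
  have hq1 : ((1 : ℝ) / 2) ^ n ≤ 1 := pow_le_one₀ (by norm_num) (by norm_num)
  filter_upwards [Metric.ball_mem_nhds u hq] with v hv
  rw [Metric.mem_ball, Real.dist_eq, abs_lt] at hv
  refine lt_of_le_of_lt ?_ hn
  have hvu : |v| ≤ |u| + 1 := by
    have := abs_add_le u (v - u)
    have h2 : |v - u| ≤ 1 := abs_le.2 ⟨by linarith, by linarith⟩
    rw [add_sub_cancel] at this
    linarith
  have hρ : 0 < 1 - ρ := by linarith
  have hn0 : 0 ≤ ρ ^ n := by positivity
  rcases le_total u v with huv | huv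
  · rw [dist_comm, Real.dist_eq]
    refine (h.abs_deriv_sub_deriv_le hR h0 h1 hf huv (n := n) (by linarith)).trans ?_
    simp only [K]
    gcongr ?_ * _
    gcongr R * ?_ + (R * ?_ + R * ?_) / _ <;> linarith
  · rw [Real.dist_eq]
    refine (h.abs_deriv_sub_deriv_le hR h0 h1 hf huv (n := n) (by linarith)).trans ?_
    simp only [K]
    gcongr ?_ * _
    gcongr R * ?_ + (R * ?_ + R * ?_) / _ <;> linarith

/-- From position `0` there are `k` unit jumps, each at most `R (1 + k)`. This sum is the source of
the quadratic growth. -/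
theorem abs_slope_zero_nat_le (h : DyadicJumpBound f R ρ) (hR : 0 ≤ R) (k : ℕ) :
    |dyadicSlope f 0 k| ≤ |dyadicSlope f 0 0| + k * (R * (1 + k)) ∧
    |dyadicSlope f 0 (-k)| ≤ |dyadicSlope f 0 0| + k * (R * (1 + k)) := by
  induction k with
  | zero => simp
  | succ k ih =>
    have a := h 0 k
    have b := h 0 (-(k + 1))
    have e : (-((k : ℤ) + 1) + 1) = -(k : ℤ) := by ring
    rw [e] at b
    have hb : |((-((k : ℤ) + 1) : ℤ) : ℝ)| = k + 1 := by
      push_cast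
      rw [abs_neg, abs_of_nonneg (by positivity)]
    rw [hb] at b
    simp only [pow_zero, mul_one, div_one, Int.cast_natCast, Nat.abs_cast] at a b
    push_cast
    have hR' : 0 ≤ R * k := by positivity
    obtain ⟨i1, i2⟩ := ih
    constructor
    · have := abs_add_le (dyadicSlope f 0 (k + 1) - dyadicSlope f 0 k) (dyadicSlope f 0 k)
      rw [sub_add_cancel] at this
      nlinarith
    · have := abs_add_le (-(dyadicSlope f 0 (-k) - dyadicSlope f 0 (-(k + 1))))
        (dyadicSlope f 0 (-k))
      rw [abs_neg, neg_sub, sub_add_cancel] at this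
      nlinarith

theorem abs_slope_zero_le (h : DyadicJumpBound f R ρ) (hR : 0 ≤ R) (k : ℤ) :
    |dyadicSlope f 0 k| ≤ |dyadicSlope f 0 0| + |(k : ℝ)| * (R * (1 + |(k : ℝ)|)) := by
  obtain ⟨n, rfl | rfl⟩ := k.eq_nat_or_neg
  · simpa using (h.abs_slope_zero_nat_le hR n).1
  · simpa using (h.abs_slope_zero_nat_le hR n).2

/-- Compare with the level-zero slope. The constants come from `(1 + |u|)(2 + |u|) ≤ 4 (1 + u²)` for
that slope and `2 + |u| ≤ 3 (1 + u²)` for the error. -/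
theorem abs_deriv_le (h : DyadicJumpBound f R ρ) (hR : 0 ≤ R) (h0 : 0 ≤ ρ) (h1 : ρ < 1)
    (hf : Differentiable ℝ f) (u : ℝ) :
    |deriv f u| ≤ (|dyadicSlope f 0 0| + (4 + 3 / (1 - ρ)) * R) * (1 + u ^ 2) := by
  have hρ : 0 < 1 - ρ := by linarith
  have a := h.abs_sub_deriv_le hR h0 h1 hf 0 u
  have b := h.abs_slope_zero_le hR ⌊2 ^ 0 * u⌋
  have c := abs_floor_div_two_pow_le 0 u
  rw [pow_zero, div_one] at c
  rw [pow_zero ρ, mul_one] at a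
  have hu := abs_nonneg u
  have hsq : u ^ 2 = |u| ^ 2 := (sq_abs u).symm
  have d1 : 2 + |u| ≤ 3 * (1 + u ^ 2) := by nlinarith [sq_nonneg (|u| - 1)]
  have a' : R * (2 + |u|) / (1 - ρ) ≤ 3 / (1 - ρ) * R * (1 + u ^ 2) := by
    calc R * (2 + |u|) / (1 - ρ) ≤ R * (3 * (1 + u ^ 2)) / (1 - ρ) := by gcongr
      _ = _ := by ring
  have b' : |(⌊(2 : ℝ) ^ 0 * u⌋ : ℝ)| * (R * (1 + |(⌊(2 : ℝ) ^ 0 * u⌋ : ℝ)|)) ≤ 4 * R * (1 + u ^ 2) := by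
    calc _ ≤ (1 + |u|) * (R * (1 + (1 + |u|))) := by simp only [pow_zero]; gcongr
      _ = R * ((1 + |u|) * (2 + |u|)) := by ring
      _ ≤ R * (4 * (1 + u ^ 2)) := by
        refine mul_le_mul_of_nonneg_left ?_ hR
        nlinarith [sq_nonneg (|u| - 1)]
      _ = _ := by ring
  have t := abs_sub_abs_le_abs_sub (deriv f u) (dyadicSlope f 0 ⌊2 ^ 0 * u⌋)
  rw [abs_sub_comm] at t
  simp only [pow_zero] at *
  have d := abs_nonneg (dyadicSlope f 0 0)
  nlinarith [sq_nonneg u, mul_nonneg d (sq_nonneg u)]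

end DyadicJumpBound

/-! ### Moments of centered Gaussian variables. -/

section Gaussian

variable {Ω : Type*} [MeasurableSpace Ω] {P : Measure Ω} {X : Ω → ℝ}

/-- Scaling one fixed standard normal variable, zero variance included, makes every moment a
universal constant times a power of the variance. -/
theorem map_eq_standardGaussian_map (hX : HasGaussianLaw X P) (h0 : ∫ ω, X ω ∂P = 0) :
    P.map X = (gaussianReal 0 1).map (√(Var[X; P]) * ·) := by
  rw [hX.map_eq_gaussianReal, h0, gaussianReal_map_const_mul]
  congr 1
  · simp
  · ext
    simp [Real.sq_sqrt (variance_nonneg X P), variance_nonneg X P]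

theorem eLpNorm_eq_of_hasGaussianLaw (hX : HasGaussianLaw X P) (h0 : ∫ ω, X ω ∂P = 0)
    (p : ℝ≥0∞) :
    eLpNorm X p P = ENNReal.ofReal (√(Var[X; P])) * eLpNorm id p (gaussianReal 0 1) := by
  have h1 : eLpNorm X p P = eLpNorm id p (P.map X) := by
    rw [eLpNorm_map_measure aestronglyMeasurable_id hX.aemeasurable]
    rfl
  have h2 : eLpNorm (id ∘ (√(Var[X; P]) * ·)) p (gaussianReal 0 1) =
      ‖√(Var[X; P])‖ₑ * eLpNorm id p (gaussianReal 0 1) :=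
    eLpNorm_const_smul (√(Var[X; P])) (id : ℝ → ℝ) p (gaussianReal 0 1)
  rw [h1, map_eq_standardGaussian_map hX h0,
    eLpNorm_map_measure aestronglyMeasurable_id (by fun_prop), h2,
    Real.enorm_of_nonneg (Real.sqrt_nonneg _)]

theorem lintegral_pow_eq_of_hasGaussianLaw (hX : HasGaussianLaw X P) (h0 : ∫ ω, X ω ∂P = 0)
    (m : ℕ) :
    ∫⁻ ω, ‖X ω‖ₑ ^ (2 * m) ∂P =
      ENNReal.ofReal (Var[X; P]) ^ m * ∫⁻ x, ‖x‖ₑ ^ (2 * m) ∂(gaussianReal 0 1) := by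
  have h1 : ∫⁻ ω, ‖X ω‖ₑ ^ (2 * m) ∂P = ∫⁻ x, ‖x‖ₑ ^ (2 * m) ∂(P.map X) :=
    (lintegral_map' (f := fun x : ℝ => ‖x‖ₑ ^ (2 * m)) (by fun_prop) hX.aemeasurable).symm
  rw [h1, map_eq_standardGaussian_map hX h0, lintegral_map (by fun_prop) (by fun_prop),
    ← lintegral_const_mul _ (by fun_prop)]
  refine lintegral_congr fun x => ?_
  rw [enorm_mul, mul_pow, pow_mul ‖√_‖ₑ, Real.enorm_of_nonneg (Real.sqrt_nonneg _),
    ← ENNReal.ofReal_pow (Real.sqrt_nonneg _), Real.sq_sqrt (variance_nonneg X P)]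

theorem lintegral_pow_gaussianReal_lt_top (m : ℕ) (hm : m ≠ 0) :
    ∫⁻ x, ‖x‖ₑ ^ (2 * m) ∂(gaussianReal 0 1) < ∞ := by
  have h := (memLp_id_gaussianReal (μ := 0) (v := 1) ((2 * m : ℕ) : ℝ≥0)).2
  have h' := (eLpNorm_lt_top_iff_lintegral_rpow_enorm_lt_top
    (by simp [hm]) ENNReal.coe_ne_top).1 h
  simpa [← ENNReal.rpow_natCast] using h'

end Gaussian

/-! ### Covariances of slopes through the mixed derivative. -/

section MixedDifference

/-- The mixed second partial derivative. -/
noncomputable def mixedDeriv (c : ℝ × ℝ → ℝ) (p : ℝ × ℝ) : ℝ :=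
  deriv (fun u => deriv (fun v => c (u, v)) p.2) p.1

theorem exists_mixedDeriv_eq {c : ℝ × ℝ → ℝ} (hc : ContDiff ℝ 2 c) {a b x y : ℝ} (hab : a < b)
    (hxy : x < y) :
    ∃ ξ ∈ Set.Ioo a b, ∃ η ∈ Set.Ioo x y,
      c (b, y) - c (b, x) - (c (a, y) - c (a, x)) = (b - a) * (y - x) * mixedDeriv c (ξ, η) := by
  have hd : Differentiable ℝ c := hc.differentiable (by norm_num)
  have hv : ∀ u v, HasDerivAt (fun v => c (u, v)) (fderiv ℝ c (u, v) (0, 1)) v := fun u v =>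
    (hd (u, v)).hasFDerivAt.comp_hasDerivAt v ((hasDerivAt_const v u).prodMk (hasDerivAt_id v))
  have hf : ContDiff ℝ 1 (fderiv ℝ c) := hc.fderiv_right (by norm_num)
  -- The mean value theorem is applied to the difference of the two rows, so that a single `η`
  -- serves both; it is then applied in the first variable at this `η`.
  obtain ⟨η, hη, e1⟩ := exists_hasDerivAt_eq_slope (fun v => c (b, v) - c (a, v)) _ hxy
    (fun v _ => ((hv b v).sub (hv a v)).continuousAt.continuousWithinAt)
    fun v _ => (hv b v).sub (hv a v)
  have hu : Differentiable ℝ (fun u => deriv (fun v => c (u, v)) η) := by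
    have : (fun u => deriv (fun v => c (u, v)) η) = fun u => fderiv ℝ c (u, η) (0, 1) :=
      funext fun u => (hv u η).deriv
    rw [this]
    have h1 : Differentiable ℝ (fderiv ℝ c) := hf.differentiable (by norm_num)
    have h2 : Differentiable ℝ (fun u : ℝ => (u, η)) := by fun_prop
    exact (h1.comp h2).clm_apply (differentiable_const _)
  obtain ⟨ξ, hξ, e2⟩ := exists_deriv_eq_slope (fun u => deriv (fun v => c (u, v)) η) hab
    hu.continuous.continuousOn hu.differentiableOn
  refine ⟨ξ, hξ, η, hη, ?_⟩
  rw [mixedDeriv, e2]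
  simp only [(hv _ _).deriv]
  have h1 : b - a ≠ 0 := by linarith
  have h2 : y - x ≠ 0 := by linarith
  rw [e1]
  field_simp
  ring

end MixedDifference

theorem memLp_two_of_isGaussianProcess {Ω T : Type*} [MeasurableSpace Ω] {P : Measure Ω}
    {Z : T → Ω → ℝ} (hZ : IsGaussianProcess Z P) (t : T) : MemLp (Z t) 2 P :=
  (hZ.hasGaussianLaw_eval t).memLp_two

namespace IsGaussianPotential

variable {Ω : Type*} [MeasurableSpace Ω] {P : Measure Ω} {V : ℝ → Ω → ℝ}

theorem isGaussianProcess_dyadicSlope (hV : IsGaussianPotential V P) (n : ℕ) :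
    IsGaussianProcess (fun (k : ℤ) ω => dyadicSlope (fun u => V u ω) n k) P := by
  classical
  exact hV.isGaussianProcess.of_isGaussianProcess fun k =>
    ⟨{((k : ℝ) + 1) / 2 ^ n, (k : ℝ) / 2 ^ n},
      { toFun x := 2 ^ n * (x ⟨((k : ℝ) + 1) / 2 ^ n, by simp⟩ - x ⟨(k : ℝ) / 2 ^ n, by simp⟩)
        map_add' x y := by simp; ring
        map_smul' c x := by simp; ring },
      fun ω => by simp [dyadicSlope]⟩

theorem integral_dyadicSlope (hV : IsGaussianPotential V P) (n : ℕ) (k : ℤ) :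
    ∫ ω, dyadicSlope (fun u => V u ω) n k ∂P = 0 := by
  have hi : ∀ u, Integrable (V u) P := fun u => (hV.isGaussianProcess.hasGaussianLaw_eval u).integrable
  simp only [dyadicSlope]
  rw [integral_const_mul, integral_sub (hi _) (hi _), hV.centered, hV.centered]
  simp

theorem exists_covariance_dyadicSlope [IsProbabilityMeasure P] (hV : IsGaussianPotential V P) (n : ℕ) (k l : ℤ) :
    ∃ ξ ∈ Set.Ioo ((k : ℝ) / 2 ^ n) ((k + 1) / 2 ^ n),
    ∃ η ∈ Set.Ioo ((l : ℝ) / 2 ^ n) ((l + 1) / 2 ^ n),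
      cov[fun ω => dyadicSlope (fun u => V u ω) n k, fun ω => dyadicSlope (fun u => V u ω) n l; P] =
        mixedDeriv (fun p => cov[V p.1, V p.2; P]) (ξ, η) := by
  have hp : (0 : ℝ) < 2 ^ n := by positivity
  have hlt : ∀ k : ℤ, (k : ℝ) / 2 ^ n < (k + 1) / 2 ^ n := fun k => by gcongr; linarith
  have hlen : ∀ k : ℤ, ((k : ℝ) + 1) / 2 ^ n - k / 2 ^ n = (2 ^ n)⁻¹ := fun k => by
    rw [← sub_div]; simp
  obtain ⟨ξ, hξ, η, hη, e⟩ := exists_mixedDeriv_eq hV.contDiff_cov (hlt k) (hlt l)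
  refine ⟨ξ, hξ, η, hη, ?_⟩
  have hm : ∀ u, MemLp (V u) 2 P := fun u => memLp_two_of_isGaussianProcess hV.isGaussianProcess u
  simp only [dyadicSlope]
  rw [covariance_const_mul_left, covariance_const_mul_right]
  have h := covariance_sub_sub (hm ((k + 1) / 2 ^ n)) (hm (k / 2 ^ n)) (hm ((l + 1) / 2 ^ n))
    (hm (l / 2 ^ n))
  simp only [Pi.sub_def] at h
  rw [h]
  rw [hlen, hlen] at e
  simp only at e
  field_simp at e
  linear_combination e

/-- The variance is a combination, with coefficients `1, -2, 1`, of values of the mixed derivative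
at points within `2 * 2⁻ⁿ` of the diagonal point `(t, t)`. The value there cancels, and four
Lipschitz errors `2 K 2⁻ⁿ` remain, whence the constant `8 K`. -/
theorem exists_variance_jump_le [IsProbabilityMeasure P] (hV : IsGaussianPotential V P) :
    ∃ C : ℝ, 0 ≤ C ∧ ∀ (n : ℕ) (k : ℤ),
      Var[fun ω => dyadicSlope (fun u => V u ω) n (k + 1) - dyadicSlope (fun u => V u ω) n k; P] ≤
        C * (1 / 2) ^ n := by
  obtain ⟨K, hK⟩ := hV.lipschitz_mixed
  refine ⟨8 * K, by positivity, fun n k => ?_⟩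
  have hs := hV.isGaussianProcess_dyadicSlope n
  have hm := fun k => memLp_two_of_isGaussianProcess hs k
  have hvar := variance_sub (hm (k + 1)) (hm k)
  rw [← covariance_self (hm _).1.aemeasurable, ← covariance_self (hm _).1.aemeasurable] at hvar
  obtain ⟨ξ₁, hξ₁, η₁, hη₁, e₁⟩ := hV.exists_covariance_dyadicSlope n (k + 1) (k + 1)
  obtain ⟨ξ₂, hξ₂, η₂, hη₂, e₂⟩ := hV.exists_covariance_dyadicSlope n (k + 1) k
  obtain ⟨ξ₃, hξ₃, η₃, hη₃, e₃⟩ := hV.exists_covariance_dyadicSlope n k k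
  rw [e₁, e₂, e₃] at hvar
  set t : ℝ := k / 2 ^ n with ht
  have ha : ((k : ℝ) + 1) / 2 ^ n = t + (1 / 2) ^ n := by rw [ht, add_div, one_div_pow]
  have hb : (((k + 1 : ℤ) : ℝ) + 1) / 2 ^ n = t + 2 * (1 / 2) ^ n := by
    push_cast; rw [ht, one_div_pow]; ring
  have hc : ((k + 1 : ℤ) : ℝ) / 2 ^ n = t + (1 / 2) ^ n := by
    push_cast; rw [ht, add_div, one_div_pow]
  rw [hb, hc] at hξ₁ hη₁ hξ₂
  rw [ha] at hη₂ hξ₃ hη₃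
  have hq : (0 : ℝ) < (1 / 2) ^ n := by positivity
  set q : ℝ := (1 / 2) ^ n
  have key : ∀ x y : ℝ, x ∈ Set.Icc t (t + 2 * q) → y ∈ Set.Icc t (t + 2 * q) →
      |mixedDeriv (fun p => cov[V p.1, V p.2; P]) (x, y) -
        mixedDeriv (fun p => cov[V p.1, V p.2; P]) (t, t)| ≤ K * (2 * q) := by
    intro x y hx hy
    refine (hK.dist_le_mul (x, y) (t, t)).trans ?_
    gcongr
    rw [Prod.dist_eq]
    refine max_le ?_ ?_
    · rw [Real.dist_eq, abs_le]; constructor <;> linarith [hx.1, hx.2]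
    · rw [Real.dist_eq, abs_le]; constructor <;> linarith [hy.1, hy.2]
  have k₁ := abs_le.1 (key ξ₁ η₁ ⟨by linarith [hξ₁.1], by linarith [hξ₁.2]⟩
    ⟨by linarith [hη₁.1], by linarith [hη₁.2]⟩)
  have k₂ := abs_le.1 (key ξ₂ η₂ ⟨by linarith [hξ₂.1], by linarith [hξ₂.2]⟩
    ⟨by linarith [hη₂.1], by linarith [hη₂.2]⟩)
  have k₃ := abs_le.1 (key ξ₃ η₃ ⟨by linarith [hξ₃.1], by linarith [hξ₃.2]⟩
    ⟨by linarith [hη₃.1], by linarith [hη₃.2]⟩)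
  refine hvar.le.trans ?_
  linarith [k₁.2, k₂.1, k₃.2]

end IsGaussianPotential

/-! ### One random constant for all jumps. -/

theorem aemeasurable_apply_countable {Ω ι : Type*} [MeasurableSpace Ω] {P : Measure Ω}
    [Countable ι] [MeasurableSpace ι] [MeasurableSingletonClass ι] {A : ι → Ω → ℝ} {N : Ω → ι}
    (hA : ∀ i, AEMeasurable (A i) P) (hN : AEMeasurable N P) :
    AEMeasurable (fun ω => A (N ω) ω) P := by
  have h : Measurable (fun p : Ω × ι => (hA p.2).mk _ p.1) :=
    measurable_from_prod_countable_left fun i => (hA i).measurable_mk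
  refine ⟨fun ω => (hA (hN.mk N ω)).mk _ ω, h.comp (measurable_id.prodMk hN.measurable_mk), ?_⟩
  filter_upwards [hN.ae_eq_mk, ae_all_iff.2 fun i => (hA i).ae_eq_mk] with ω h1 h2
  rw [← h1, h2]

/-- The weight of the jump at position `k` on level `n` in `exists_jumpBound`. -/
noncomputable def jumpWeight (m n : ℕ) (k : ℤ) : ℝ :=
  (4 * ((8 / 7) ^ 2) ^ m) ^ n * (1 + (k : ℝ) ^ 2)⁻¹

theorem jumpWeight_pos (m n : ℕ) (k : ℤ) : 0 < jumpWeight m n k := by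
  unfold jumpWeight; positivity

theorem summable_one_add_sq_inv : Summable (fun k : ℤ => (1 + (k : ℝ) ^ 2)⁻¹) := by
  have h := (Real.summable_one_div_int_pow (p := 2)).2 (by norm_num)
  refine h.of_norm_bounded_eventually ?_
  rw [Filter.eventually_cofinite]
  refine (Set.finite_singleton (0 : ℤ)).subset fun k hk => ?_
  by_contra hne
  refine hk ?_
  have hk0 : (0 : ℝ) < (k : ℝ) ^ 2 := by
    have : (k : ℝ) ≠ 0 := by exact_mod_cast hne
    positivity
  rw [Real.norm_of_nonneg (by positivity), one_div]
  gcongr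
  linarith

/-- Standard deviations decay like `2^(-n/2)`. The slower target rate `7/8 > 1/√2` makes `(8/7)² / 2
= 32/49 < 1`, and its fourth power is the first to absorb the factor `4`. -/
theorem geometric_jump_ratio_lt_one {m : ℕ} (hm : 4 ≤ m) :
    4 * ((8 / 7) ^ 2) ^ m * (1 / 2 : ℝ) ^ m < 1 := by
  rw [mul_assoc, ← mul_pow]
  calc 4 * ((8 / 7) ^ 2 * (1 / 2 : ℝ)) ^ m ≤ 4 * ((8 / 7) ^ 2 * (1 / 2 : ℝ)) ^ 4 := by
        gcongr ?_ * ?_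
        exact pow_le_pow_of_le_one (by norm_num) (by norm_num) hm
    _ < 1 := by norm_num

/-- On taking `2m`-th roots, the powers of `8/7` in the weight become the decay `(7/8)^n`, while its
`4^n` compensates the factor `1 / (1 + k²)` that makes the weights summable in `k`. -/
theorem jumpWeight_bound {m n : ℕ} (hm : 4 ≤ m) {k : ℤ} {x F : ℝ} (hF : 0 ≤ F)
    (h : jumpWeight m n k * |x| ^ (2 * m) ≤ F) :
    |x| ≤ F ^ ((2 * m : ℕ) : ℝ)⁻¹ * (7 / 8) ^ n * (1 + |(k : ℝ)| / 2 ^ n) := by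
  have h2m : 2 * m ≠ 0 := by omega
  have hp : (0 : ℝ) < 2 ^ n := by positivity
  refine le_of_pow_le_pow_left₀ h2m (by positivity) ?_
  rw [mul_pow, mul_pow, Real.rpow_inv_natCast_pow hF h2m]
  have h1 : 1 + (k : ℝ) ^ 2 ≤ 4 ^ n * (1 + |(k : ℝ)| / 2 ^ n) ^ (2 * m) := by
    have a : 1 + (k : ℝ) ^ 2 ≤ (2 ^ n * (1 + |(k : ℝ)| / 2 ^ n)) ^ 2 := by
      have e : 2 ^ n * (1 + |(k : ℝ)| / 2 ^ n) = 2 ^ n + |(k : ℝ)| := by field_simp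
      have h1 : (1 : ℝ) ≤ 2 ^ n := one_le_pow₀ (by norm_num)
      rw [e, ← sq_abs]
      nlinarith [abs_nonneg (k : ℝ)]
    have b : (1 + |(k : ℝ)| / 2 ^ n) ^ 2 ≤ (1 + |(k : ℝ)| / 2 ^ n) ^ (2 * m) :=
      pow_le_pow_right₀ (by linarith [div_nonneg (abs_nonneg (k : ℝ)) hp.le]) (by omega)
    calc _ ≤ _ := a
      _ = 4 ^ n * (1 + |(k : ℝ)| / 2 ^ n) ^ 2 := by
        rw [mul_pow, ← pow_mul, mul_comm n, pow_mul]; norm_num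
      _ ≤ _ := by gcongr
  have h3 : ((7 / 8 : ℝ) ^ n) ^ (2 * m) * (((8 / 7) ^ 2) ^ m) ^ n = 1 := by
    rw [← pow_mul (8 / 7 : ℝ), ← pow_mul, ← pow_mul, mul_comm n, ← mul_pow]
    norm_num
  set T := (1 + |(k : ℝ)| / 2 ^ n) ^ (2 * m)
  have hT : 0 ≤ T := by positivity
  have hk : 0 < 1 + (k : ℝ) ^ 2 := by positivity
  calc |x| ^ (2 * m) = |x| ^ (2 * m) * ((1 + (k : ℝ) ^ 2) * (1 + (k : ℝ) ^ 2)⁻¹) := by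
        rw [mul_inv_cancel₀ hk.ne', mul_one]
    _ ≤ |x| ^ (2 * m) * (4 ^ n * T * (1 + (k : ℝ) ^ 2)⁻¹) := by gcongr
    _ = |x| ^ (2 * m) * (4 ^ n * T * (1 + (k : ℝ) ^ 2)⁻¹) *
        (((7 / 8 : ℝ) ^ n) ^ (2 * m) * (((8 / 7) ^ 2) ^ m) ^ n) := by rw [h3, mul_one]
    _ = (jumpWeight m n k * |x| ^ (2 * m)) * ((7 / 8 : ℝ) ^ n) ^ (2 * m) * T := by
        rw [jumpWeight, mul_pow]; ring
    _ ≤ F * ((7 / 8 : ℝ) ^ n) ^ (2 * m) * T := by gcongr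

/-- A doubly indexed family of random variables whose moments of order `2 m` decay geometrically
in the level is dominated by a single random variable in `L^(2 m)`. -/
theorem exists_jumpBound {Ω : Type*} [MeasurableSpace Ω] {P : Measure Ω} {J : ℕ → ℤ → Ω → ℝ}
    (hJ : ∀ n k, AEMeasurable (J n k) P) {m : ℕ} (hm : 4 ≤ m) {B : ℝ≥0}
    (hB : ∀ n k, ∫⁻ ω, ‖J n k ω‖ₑ ^ (2 * m) ∂P ≤ ENNReal.ofReal (B * ((1 / 2) ^ m) ^ n)) :
    ∃ G : Ω → ℝ, (∀ ω, 0 ≤ G ω) ∧ MemLp G ((2 * m : ℕ) : ℝ≥0) P ∧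
      ∀ᵐ ω ∂P, ∀ n k, |J n k ω| ≤ G ω * (7 / 8) ^ n * (1 + |(k : ℝ)| / 2 ^ n) := by
  set F : Ω → ℝ≥0∞ := fun ω =>
    ∑' n, ∑' k, ENNReal.ofReal (jumpWeight m n k) * ‖J n k ω‖ₑ ^ (2 * m) with hF
  have hterm : ∀ n k, AEMeasurable
      (fun ω => ENNReal.ofReal (jumpWeight m n k) * ‖J n k ω‖ₑ ^ (2 * m)) P := fun n k =>
    ((hJ n k).enorm.pow_const _).const_mul _
  have hFm : AEMeasurable F P :=
    AEMeasurable.tsum fun n => AEMeasurable.tsum fun k => hterm n k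
  set r : ℝ := 4 * ((8 / 7) ^ 2) ^ m * (1 / 2) ^ m with hr
  have hr0 : 0 ≤ r := by positivity
  have hr1 : r < 1 := geometric_jump_ratio_lt_one hm
  have hFint : ∫⁻ ω, F ω ∂P < ∞ := by
    rw [hF, lintegral_tsum fun n => AEMeasurable.tsum fun k => hterm n k]
    calc ∑' n, ∫⁻ ω, ∑' k, ENNReal.ofReal (jumpWeight m n k) * ‖J n k ω‖ₑ ^ (2 * m) ∂P
        = ∑' n, ∑' k, ∫⁻ ω, ENNReal.ofReal (jumpWeight m n k) * ‖J n k ω‖ₑ ^ (2 * m) ∂P := by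
          congr 1; ext n; exact lintegral_tsum fun k => hterm n k
      _ ≤ ∑' n : ℕ, ∑' k : ℤ, ENNReal.ofReal (B * r ^ n) * ENNReal.ofReal ((1 + (k : ℝ) ^ 2)⁻¹) := by
          refine ENNReal.tsum_le_tsum fun n => ENNReal.tsum_le_tsum fun k => ?_
          rw [lintegral_const_mul'' _ ((hJ n k).enorm.pow_const _)]
          refine (mul_le_mul_right (hB n k) _).trans (le_of_eq ?_)
          rw [← ENNReal.ofReal_mul (jumpWeight_pos m n k).le, ← ENNReal.ofReal_mul (by positivity)]
          congr 1
          rw [jumpWeight, hr, mul_pow (4 * _) ((1 / 2 : ℝ) ^ m) n]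
          ring
      _ = ENNReal.ofReal (∑' n : ℕ, (B * r ^ n)) *
          ENNReal.ofReal (∑' k : ℤ, (1 + (k : ℝ) ^ 2)⁻¹) := by
          simp_rw [ENNReal.tsum_mul_left, ENNReal.tsum_mul_right]
          rw [ENNReal.ofReal_tsum_of_nonneg (fun n => by positivity)
            ((summable_geometric_of_lt_one hr0 hr1).mul_left _),
            ENNReal.ofReal_tsum_of_nonneg (fun n => by positivity) summable_one_add_sq_inv]
      _ < ∞ := ENNReal.mul_lt_top ENNReal.ofReal_lt_top ENNReal.ofReal_lt_top
  have h2m : 2 * m ≠ 0 := by omega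
  have hG0 : ∀ ω, 0 ≤ (F ω).toReal ^ ((2 * m : ℕ) : ℝ)⁻¹ := fun ω => by positivity
  -- Then `G^(2m) ≤ F` is integrable. Where `F = ∞` the value of `G` is `0` and the bound may fail,
  -- but this set is null.
  refine ⟨fun ω => (F ω).toReal ^ ((2 * m : ℕ) : ℝ)⁻¹, hG0, ⟨?_, ?_⟩, ?_⟩
  · exact (hFm.ennreal_toReal.pow_const _).aestronglyMeasurable
  · rw [eLpNorm_lt_top_iff_lintegral_rpow_enorm_lt_top
      (by exact_mod_cast h2m) ENNReal.coe_ne_top]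
    refine lt_of_le_of_lt (lintegral_mono fun ω => ?_) hFint
    have e : (((2 * m : ℕ) : ℝ≥0) : ℝ≥0∞).toReal = ((2 * m : ℕ) : ℝ) := by simp
    rw [e, ENNReal.rpow_natCast, Real.enorm_of_nonneg (hG0 ω), ← ENNReal.ofReal_pow (hG0 ω),
      Real.rpow_inv_natCast_pow ENNReal.toReal_nonneg h2m]
    exact ENNReal.ofReal_toReal_le
  · filter_upwards [ae_lt_top' hFm hFint.ne] with ω hω n k
    refine jumpWeight_bound hm ENNReal.toReal_nonneg ?_
    have h1 : ENNReal.ofReal (jumpWeight m n k) * ‖J n k ω‖ₑ ^ (2 * m) ≤ F ω :=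
      (ENNReal.le_tsum (f := fun k => ENNReal.ofReal (jumpWeight m n k) * ‖J n k ω‖ₑ ^ (2 * m)) k).trans
        (ENNReal.le_tsum (f := fun n => ∑' k,
          ENNReal.ofReal (jumpWeight m n k) * ‖J n k ω‖ₑ ^ (2 * m)) n)
    have h2 := ENNReal.toReal_mono hω.ne h1
    rwa [ENNReal.toReal_mul, ENNReal.toReal_ofReal (jumpWeight_pos m n k).le, ENNReal.toReal_pow,
      toReal_enorm, Real.norm_eq_abs] at h2

/-! ### Continuity and growth of the force `V'`. -/

namespace IsGaussianPotential

variable {Ω : Type*} [MeasurableSpace Ω] {P : Measure Ω} [IsProbabilityMeasure P] {V : ℝ → Ω → ℝ}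

theorem exists_dyadicJumpBound (hV : IsGaussianPotential V P) {m : ℕ} (hm : 4 ≤ m) :
    ∃ G : Ω → ℝ, (∀ ω, 0 ≤ G ω) ∧ MemLp G ((2 * m : ℕ) : ℝ≥0) P ∧
      ∀ᵐ ω ∂P, DyadicJumpBound (fun u => V u ω) (G ω) (7 / 8) := by
  obtain ⟨C, hC, hvar⟩ := hV.exists_variance_jump_le
  have hs := fun n => hV.isGaussianProcess_dyadicSlope n
  have hint := fun n k => ((hs n).hasGaussianLaw_eval k).integrable
  obtain ⟨M, hM⟩ : ∃ M : ℝ≥0, (M : ℝ≥0∞) = ∫⁻ x, ‖x‖ₑ ^ (2 * m) ∂(gaussianReal 0 1) :=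
    ⟨_, ENNReal.coe_toNNReal (lintegral_pow_gaussianReal_lt_top m (by omega)).ne⟩
  refine exists_jumpBound
    (J := fun n k ω => dyadicSlope (fun u => V u ω) n (k + 1) - dyadicSlope (fun u => V u ω) n k)
    (fun n k => ((hs n).aemeasurable _).sub ((hs n).aemeasurable _)) hm
    (B := (C ^ m).toNNReal * M) fun n k => ?_
  rw [lintegral_pow_eq_of_hasGaussianLaw ((hs n).hasGaussianLaw_fun_sub (s := k + 1) (t := k))
    (by rw [integral_sub (hint n _) (hint n _), hV.integral_dyadicSlope, hV.integral_dyadicSlope,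
      sub_zero])]
  rw [← hM, ← ENNReal.ofReal_coe_nnreal, ← ENNReal.ofReal_pow (variance_nonneg _ _),
    ← ENNReal.ofReal_mul (pow_nonneg (variance_nonneg _ _) m)]
  refine ENNReal.ofReal_le_ofReal ?_
  rw [NNReal.coe_mul, Real.coe_toNNReal _ (by positivity)]
  calc _ ≤ (C * (1 / 2) ^ n) ^ m * M := by
        gcongr
        · exact variance_nonneg _ _
        · exact hvar n k
    _ = _ := by rw [mul_pow, ← pow_mul, mul_comm n m, pow_mul]; ring

/-- The derivative of a Gaussian potential is a continuous random function of at most quadratic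
growth. -/
theorem hasQuadraticGrowth_deriv (hV : IsGaussianPotential V P) :
    HasQuadraticGrowth (fun ω => deriv (fun u => V u ω)) P where
  continuous_paths := by
    obtain ⟨G, hG0, -, hG⟩ := hV.exists_dyadicJumpBound le_rfl
    filter_upwards [hG, hV.differentiable_paths] with ω h hd
    exact h.continuous_deriv (hG0 ω) (by norm_num) (by norm_num) hd
  growth p hp hp' := by
    -- The order `2 (k + 4)` exceeds `p` and meets the requirement `4 ≤ m`.
    obtain ⟨k, hk⟩ := ENNReal.exists_nat_gt hp'
    obtain ⟨G, hG0, hGp, hG⟩ := hV.exists_dyadicJumpBound (m := k + 4) (by omega)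
    have hle : p ≤ (((2 * (k + 4) : ℕ) : ℝ≥0) : ℝ≥0∞) := by
      refine hk.le.trans ?_
      rw [ENNReal.coe_natCast]
      exact_mod_cast (by omega : k ≤ 2 * (k + 4))
    have h0 : MemLp (fun ω => dyadicSlope (fun u => V u ω) 0 0) p P :=
      ((hV.isGaussianProcess_dyadicSlope 0).hasGaussianLaw_eval 0).memLp hp'
    refine ⟨fun ω => |dyadicSlope (fun u => V u ω) 0 0| + (4 + 3 / (1 - 7 / 8)) * G ω,
      h0.norm.add ((hGp.mono_exponent hle).const_mul _), ?_⟩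
    filter_upwards [hG, hV.differentiable_paths] with ω h hd u
    exact h.abs_deriv_le (hG0 ω) (by norm_num) (by norm_num) hd u
  aemeasurable_comp Y hY := by
    -- Joint measurability of `V` is not assumed. At the random point `Y`, the derivative is an
    -- almost sure limit of slopes with a countably valued random index.
    refine aemeasurable_of_tendsto_metrizable_ae atTop
      (f := fun (n : ℕ) ω => dyadicSlope (fun u => V u ω) n ⌊2 ^ n * Y ω⌋) (fun n => ?_) ?_
    · exact aemeasurable_apply_countable
        (fun k => (hV.isGaussianProcess_dyadicSlope n).aemeasurable k)
        (Int.measurable_floor.comp_aemeasurable (hY.const_mul _))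
    · filter_upwards [hV.differentiable_paths] with ω hd
      exact tendsto_dyadicSlope (hd _).hasDerivAt

end IsGaussianPotential

/-! ### Continuity of the initial fields. -/

theorem abs_sub_le_of_lineDeriv_le {E : Type*} [AddCommGroup E] [Module ℝ E] {k : E → ℝ}
    {x v : E} {C r : ℝ}
    (h : ∀ t ∈ Set.uIcc 0 r, LineDifferentiableAt ℝ k (x + t • v) v ∧
      |lineDeriv ℝ k (x + t • v) v| ≤ C) :
    |k (x + r • v) - k x| ≤ C * |r| := by
  have hd : ∀ t ∈ Set.uIcc 0 r,
      HasDerivAt (fun t : ℝ => k (x + t • v)) (lineDeriv ℝ k (x + t • v) v) t := by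
    intro t ht
    have h0 : HasDerivAt (fun s : ℝ => k (x + t • v + s • v)) (lineDeriv ℝ k (x + t • v) v)
        (t - t) := by
      rw [sub_self]
      exact (h t ht).1.hasDerivAt
    have h1 := h0.comp_sub_const t t
    refine h1.congr_of_eventuallyEq (Eventually.of_forall fun s => ?_)
    simp only
    congr 1
    module
  have := (convex_uIcc (0 : ℝ) r).norm_image_sub_le_of_norm_hasDerivWithin_le
    (fun t ht => (hd t ht).hasDerivWithinAt) (fun t ht => (h t ht).2)
    Set.left_mem_uIcc Set.right_mem_uIcc
  simpa using this

/-- These two differences are exactly what the variance of `Z s - Z s₀` consists of, once the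
symmetry of the covariance is used. -/
theorem HasBoundedPartials.exists_abs_sub_le {S : Set Plane} {c : S → S → ℝ}
    (hc : HasBoundedPartials S c) (s₀ : S) :
    ∃ C : ℝ, ∀ᶠ s in 𝓝 s₀, |c s s - c s s₀| ≤ C * dist s s₀ ∧
      |c s₀ s - c s₀ s₀| ≤ C * dist s s₀ := by
  obtain ⟨U, k, C, hU, hSU, hk, hb⟩ := hc
  have hC : 0 ≤ C := (abs_nonneg _).trans (hb (s₀, s₀) (hSU ⟨s₀.2, s₀.2⟩) 0).1.2
  obtain ⟨ε, hε, hball⟩ := Metric.isOpen_iff.1 hU ((s₀ : Plane), (s₀ : Plane)) (hSU ⟨s₀.2, s₀.2⟩)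
  have hmem : ∀ a b : Plane, dist a s₀ < ε → dist b s₀ < ε → (a, b) ∈ U := fun a b ha hb =>
    hball (by rw [Metric.mem_ball, Prod.dist_eq]; exact max_lt ha hb)
  have key : ∀ a s : Plane, dist a s₀ < ε → dist s s₀ < ε →
      |k (a, s) - k (a, s₀)| ≤ 2 * C * dist s s₀ := by
    intro a s ha hs
    have hcoord : ∀ i, |s i - (s₀ : Plane) i| ≤ dist s s₀ := fun i => by
      rw [dist_eq_norm]
      exact PiLp.norm_apply_le (s - (s₀ : Plane)) i
    have hdist : ∀ x : Plane, (∀ i, |x i - (s₀ : Plane) i| ≤ |s i - (s₀ : Plane) i|) →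
        dist x s₀ ≤ dist s s₀ := fun x hx => by
      rw [EuclideanSpace.dist_eq, EuclideanSpace.dist_eq]
      gcongr with i
      exact hx i
    have huIcc : ∀ {t r : ℝ}, t ∈ Set.uIcc 0 r → |t| ≤ |r| := fun ht => by
      simpa using Set.abs_sub_left_of_mem_uIcc ht
    set r : Fin 2 → ℝ := fun i => s i - (s₀ : Plane) i with hr
    set e : Fin 2 → Plane := fun i => EuclideanSpace.single i 1 with he
    -- Only partial derivatives exist, so the path from `s₀` to `s` follows the two axes. It stays
    -- in the ball, where the bounds hold though it may leave `S`; the two legs give the factor `2`.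
    have hs' : s = (s₀ : Plane) + r 0 • e 0 + r 1 • e 1 := by
      ext i
      fin_cases i <;> simp [hr, he]
    have h0 := abs_sub_le_of_lineDeriv_le (k := k) (x := (a, (s₀ : Plane))) (v := (0, e 0))
      (C := C) (r := r 0) fun t ht => (hb _ (by
        simp only [Prod.smul_mk, Prod.mk_add_mk, smul_zero, add_zero]
        refine hmem _ _ ha ((hdist _ fun i => ?_).trans_lt hs)
        fin_cases i
        · simpa [he] using huIcc ht
        · simp [he]) 0).2
    have h1 := abs_sub_le_of_lineDeriv_le (k := k) (x := (a, (s₀ : Plane) + r 0 • e 0))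
      (v := (0, e 1)) (C := C) (r := r 1) fun t ht => (hb _ (by
        simp only [Prod.smul_mk, Prod.mk_add_mk, smul_zero, add_zero]
        refine hmem _ _ ha ((hdist _ fun i => ?_).trans_lt hs)
        fin_cases i
        · simp [he, hr]
        · simpa [he] using huIcc ht) 1).2
    simp only [Prod.smul_mk, Prod.mk_add_mk, smul_zero, add_zero] at h0 h1
    rw [← hs'] at h1
    have c0 := mul_le_mul_of_nonneg_left (hcoord 0) hC
    have c1 := mul_le_mul_of_nonneg_left (hcoord 1) hC
    have := abs_sub_le (k (a, s)) (k (a, (s₀ : Plane) + r 0 • e 0)) (k (a, s₀))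
    linarith
  refine ⟨2 * C, ?_⟩
  filter_upwards [Metric.ball_mem_nhds s₀ hε] with s hs
  simp only [← hk]
  exact ⟨key s s hs hs, key s₀ s (by simpa using hε) hs⟩

theorem IsInitialField.continuousInLp {Ω : Type*} [MeasurableSpace Ω] {S : Set Plane}
    {Z : S → Ω → ℝ} {P : Measure Ω} [IsProbabilityMeasure P] (hZ : IsInitialField S Z P) :
    ContinuousInLp Z P := by
  intro p hp hp'
  refine ⟨fun s => (hZ.isGaussianProcess.hasGaussianLaw_eval s).memLp hp', fun s₀ => ?_⟩
  have hi := fun s => (hZ.isGaussianProcess.hasGaussianLaw_eval s).integrable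
  have hm := fun s => memLp_two_of_isGaussianProcess hZ.isGaussianProcess s
  have he : ∀ s, eLpNorm (Z s - Z s₀) p P =
      ENNReal.ofReal (√(Var[Z s - Z s₀; P])) * eLpNorm id p (gaussianReal 0 1) := fun s =>
    eLpNorm_eq_of_hasGaussianLaw hZ.isGaussianProcess.hasGaussianLaw_sub
      (by simp only [Pi.sub_apply]; rw [integral_sub (hi _) (hi _), hZ.centered, hZ.centered, sub_zero]) p
  have hγ : eLpNorm id p (gaussianReal 0 1) ≠ ∞ := by
    lift p to ℝ≥0 using hp'
    exact (memLp_id_gaussianReal p).2.ne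
  obtain ⟨C, hC⟩ := hZ.boundedPartials.exists_abs_sub_le s₀
  have hvar : Tendsto (fun s => Var[Z s - Z s₀; P]) (𝓝 s₀) (𝓝 0) := by
    have hlim : Tendsto (fun s => 2 * C * dist s s₀) (𝓝 s₀) (𝓝 0) := by
      have : Continuous fun s => 2 * C * dist s s₀ := by fun_prop
      simpa using this.tendsto s₀
    refine tendsto_of_tendsto_of_tendsto_of_le_of_le' tendsto_const_nhds hlim
      (Eventually.of_forall fun s => variance_nonneg _ _) ?_
    filter_upwards [hC] with s hs
    rw [variance_sub (hm s) (hm s₀), ← covariance_self (hm s).1.aemeasurable,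
      ← covariance_self (hm s₀).1.aemeasurable]
    have h1 := (abs_le.1 hs.1).2
    have h2 := (abs_le.1 hs.2).1
    rw [covariance_comm (Z s₀) (Z s)] at h2
    linarith
  simp_rw [he]
  have h1 := ENNReal.tendsto_ofReal ((Real.continuous_sqrt.tendsto 0).comp hvar)
  rw [Real.sqrt_zero, ENNReal.ofReal_zero] at h1
  simpa using ENNReal.Tendsto.mul_const h1 (.inr hγ)

/-! ### The mass and the induction over time steps. -/

theorem continuous_coordSq : Continuous coordSq := by
  unfold coordSq
  fun_prop

theorem continuous_mass {S : Set Plane} (hS : IsCompact S) : Continuous (mass S) := by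
  have : CompactSpace S := isCompact_iff_compactSpace.1 hS
  have h := (isCompact_univ (X := S)).continuous_sSup
    (f := fun (s : Plane) (u : S) => ‖coordSq s - coordSq u‖ ^ 2)
    (((((continuous_coordSq.comp continuous_fst).sub
      (continuous_coordSq.comp (continuous_subtype_val.comp continuous_snd))).norm).pow 2))
  simp only [Set.image_univ] at h
  exact Real.continuous_exp.comp h

theorem continuousInLp_leapfrogState {Ω : Type*} [MeasurableSpace Ω] {P : Measure Ω}
    [IsProbabilityMeasure P] {S : Set Plane} (hS : IsCompact S) (α β δt : ℝ)
    {X₀ Y₀ : S → Ω → ℝ} {V : ℝ → Ω → ℝ} (hX : ContinuousInLp X₀ P) (hY : ContinuousInLp Y₀ P)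
    (hV : HasQuadraticGrowth (fun ω => deriv (fun u => V u ω)) P) (h : ℕ) :
    ContinuousInLp (observedProcess α β δt V Y₀ X₀ h) P ∧
      ContinuousInLp (latentProcess α β δt V Y₀ X₀ h) P := by
  induction h with
  | zero => exact ⟨hY, hX⟩
  | succ h ih =>
    obtain ⟨ihY, ihX⟩ := ih
    have hmass : Continuous fun s : S => δt * (mass S s)⁻¹ :=
      continuous_const.mul (((continuous_mass hS).comp continuous_subtype_val).inv₀
        fun s => (Real.exp_pos _).ne')
    have hg := ihY.comp_hasQuadraticGrowth hV
    -- The new observed process comes first, since the latent update evaluates the force there as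
    -- well.
    have hY' : ContinuousInLp (observedProcess α β δt V Y₀ X₀ (h + 1)) P := by
      refine ((ihY.const_mul β).add
        (((ihX.const_mul α).add (hg.const_mul (-(δt / 2)))).continuous_mul hmass)).congr
        fun s => funext fun ω => ?_
      simp only [observedProcess, latentProcess, leapfrogState, leapfrogStep]
      ring
    refine ⟨hY', ?_⟩
    have hg' := hY'.comp_hasQuadraticGrowth hV
    refine ((ihX.const_mul (α ^ 2)).add
      (((hg.const_mul α).add hg').const_mul (-(δt / 2)))).congr fun s => funext fun ω => ?_
    simp only [observedProcess, latentProcess, leapfrogState, leapfrogStep]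
    ring

theorem theorem3 {Ω : Type*} [MeasurableSpace Ω] (P : Measure Ω) [IsProbabilityMeasure P]
    (S : Set Plane) (hS : IsCompact S)
    (α β δt : ℝ) (hα : |α| < 1) (hβ : |β| < 1) (hδt : 0 < δt)
    (X₀ Y₀ : S → Ω → ℝ) (V : ℝ → Ω → ℝ)
    (hX : IsInitialField S X₀ P)
    (hY : IsInitialField S Y₀ P)
    (hV : IsGaussianPotential V P) :
    ∀ h : ℕ, 1 ≤ h →
      MeanSquareContinuous (observedProcess α β δt V Y₀ X₀ h) P ∧
      MeanSquareContinuous (latentProcess α β δt V Y₀ X₀ h) P := by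
  intro h _
  obtain ⟨h1, h2⟩ := continuousInLp_leapfrogState hS α β δt hX.continuousInLp hY.continuousInLp
    hV.hasQuadraticGrowth_deriv h
  exact ⟨h1.meanSquareContinuous, h2.meanSquareContinuous⟩
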